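/- **Notation.** Let $0<q<1$. Put $(a;q)_n=\prod_{i=0}^{n-1}(1-aq^i)$, $(a;q)_\infty=\prod_{i\ge 0}(1-aq^i)$, $(a_1,\dots,a_k;q)_\infty=\prod_i (a_i;q)_\infty$, $[n]_q=\frac{1-q^n}{1-q}$, $[n]_q!=[1]_q[2]_q\cdots[n]_q$, $[2m]_q!!=[2]_q[4]_q\cdots[2m]_q$, and $\binom{n}{k}_q=\frac{[n]_q!}{[k]_q!\,[n-k]_q!}$ for $0\le k\le n$, $\binom nk_q=0$ for $k>n$. The Jackson integral is $\int_0^\alpha f(x)\,d_qx=(1-q)\sum_{k\ge 0}\alpha q^k f(\alpha q^k)$ and $\int_a^b f\,d_qx=\int_0^b f\,d_qx-\int_0^a f\,d_qx$. The discrete $q$-Hermite weight is $\omega(x)=\frac{(qx,-qx;q)_\infty}{(q,-1,-q;q)_\infty}$, and the discrete $q$-Hermite polynomials are $$H_n(x;q)=\sum_{k=0}^{\lfloor n/2\rfloor}(-1)^k\frac{(q^{-n};q^2)_k\,(q^{-n+1};q^2)_k\,q^{k(2n-k)}}{(q^2;q^2)_k}\,x^{n-2k}.$$ For non-negative integers $p,j,N$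 put $$\widehat{\mathfrak m}_{2p,j}(q)=\frac{1}{(1-q)^p}\int_{-1}^1\frac{|x|^{2p}H_j(x;q)^2\,\omega(x)}{(1-q)(q;q)_j\,q^{j(j-1)/2}}\,d_qx,\qquad \rho_N(x)=\frac1{1-q}\sum_{j=0}^{N-1}\frac{H_j(x;q)^2}{(q;q)_j\,q^{j(j-1)/2}}\,\omega(x),$$ $$\widehat m_{N,2p}(q)=\int_{-1/\sqrt{1-q}}^{1/\sqrt{1-q}}|x|^{2p}\,\widehat\rho_N(x)\,d_qx,\qquad \widehat\rho_N(x)=\sqrt{1-q}\,\rho_N(\sqrt{1-q}\,x),$$ where $\rho_N$ is the density of the discrete $q$-deformed GUE with $N$ eigenvalues and $\widehat m_{N,2p}$ are its scaled spectral moments. For the GUE put $$\mathfrak m^{\rm GUE}_{2p,j}=\int_{\mathbb R}x^{2p}\,\frac{He_j(x)^2}{j!}\,\frac{e^{-x^2/2}}{\sqrt{2\pi}}\,dx,\qquad m^{\rm GUE}_{N,2p}=\sum_{j=0}^{N-1}\mathfrak m^{\rm GUE}_{2p,j},$$ with $He_j$ the (monic, probabilists') Hermite polynomials, and $(-1)!!=1$.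 **Theorem 2.1 (i) (Spectral moments of the $q$-deformed GUE, positive sum formula).** For all integers $p,j,N\ge 0$ and all $0<q<1$, the Jackson integrals above converge absolutely and $$\widehat{\mathfrak m}_{2p,j}(q)=\sum_{l=0}^p q^{(j-l)(2p-l)+l(l-1)/2}\binom{j}{l}_q\frac{[2p]_q!}{[2p-2l]_q!!\,[l]_q!},$$ $$\widehat m_{N,2p}(q)=\sum_{j=0}^{N-1}\sum_{l=0}^p q^{(j-l)(2p-l)+l(l-1)/2}\binom{j}{l}_q\frac{[2p]_q!}{[2p-2l]_q!!\,[l]_q!}.$$ Moreover, taking $q\to1^-$ one recovers the GUE moments and their positive sum formulas: $$\lim_{q\to1^-}\widehat{\mathfrak m}_{2p,j}(q)=\mathfrak m^{\rm GUE}_{2p,j}=(2p-1)!!\sum_{l=0}^p\binom jl\binom pl2^l,\qquad \lim_{q\to1^-}\widehat m_{N,2p}(q)=m^{\rm GUE}_{N,2p}=(2p-1)!!\sum_{l=0}^p\binom N{l+1}\binom pl2^l.$$ -/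

import Mathlib

namespace QGUE

open Finset

noncomputable section

/-! ### `q`-notation -/

/-- The finite `q`-Pochhammer symbol `(a; q)_n = (1 - a)(1 - aq) ⋯ (1 - aq^{n-1})`. -/
def qPoch (a q : ℝ) (n : ℕ) : ℝ := ∏ i ∈ range n, (1 - a * q ^ i)

/-- The infinite `q`-Pochhammer symbol `(a; q)_∞ = ∏_{l ≥ 0} (1 - a q^l)`. -/
def qPochInf (a q : ℝ) : ℝ := ∏' l : ℕ, (1 - a * q ^ l)

/-- The `q`-integer `[n]_q = (1 - q^n) / (1 - q)`. -/
def qInt (q : ℝ) (n : ℕ) : ℝ := (1 - q ^ n) / (1 - q)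

/-- The `q`-factorial `[n]_q! = [1]_q [2]_q ⋯ [n]_q`. -/
def qFactorial (q : ℝ) (n : ℕ) : ℝ := ∏ i ∈ range n, qInt q (i + 1)

/-- The `q`-double factorial `[n]_q!! = [n]_q [n-2]_q [n-4]_q ⋯`, ending in `[2]_q` or `[1]_q`
(and equal to `1` for `n = 0`). -/
def qDoubleFactorial (q : ℝ) : ℕ → ℝ
  | 0 => 1
  | 1 => 1
  | n + 2 => qInt q (n + 2) * qDoubleFactorial q n

/-- The `q`-binomial coefficient, which vanishes for `n < k`. -/
def qBinom (q : ℝ) (n k : ℕ) : ℝ :=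
  if k ≤ n then qFactorial q n / (qFactorial q k * qFactorial q (n - k)) else 0

/-! ### The Jackson `q`-integral -/

/-- The Jackson integral `∫_0^α f(x) d_q x = (1 - q) ∑_{k ≥ 0} α q^k f(α q^k)`. -/
def jacksonIntegralZero (q : ℝ) (f : ℝ → ℝ) (α : ℝ) : ℝ :=
  (1 - q) * ∑' k : ℕ, α * q ^ k * f (α * q ^ k)

/-- The Jackson integral `∫_a^b f(x) d_q x = ∫_0^b f(x) d_q x - ∫_0^a f(x) d_q x`. -/
def jacksonIntegral (q : ℝ) (f : ℝ → ℝ) (a b : ℝ) : ℝ :=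
  jacksonIntegralZero q f b - jacksonIntegralZero q f a

/-- Both series defining the Jackson integral `∫_a^b f(x) d_q x` converge (absolutely). -/
def JacksonIntegrable (q : ℝ) (f : ℝ → ℝ) (a b : ℝ) : Prop :=
  Summable (fun k : ℕ => a * q ^ k * f (a * q ^ k)) ∧
    Summable (fun k : ℕ => b * q ^ k * f (b * q ^ k))

/-! ### The discrete `q`-Hermite weight, polynomials and ensemble -/

/-- The discrete `q`-Hermite weight `ω(x) = (qx, -qx; q)_∞ / (q, -1, -q; q)_∞`. -/
def weight (q x : ℝ) : ℝ :=
  (qPochInf (q * x) q * qPochInf (-(q * x)) q) /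
    (qPochInf q q * qPochInf (-1) q * qPochInf (-q) q)

/-- The discrete `q`-Hermite polynomial
`H_n(x; q) = ∑_{k = 0}^{⌊n/2⌋} (-1)^k (q^{-n}; q²)_k (q^{-n+1}; q²)_k q^{k(2n-k)} / (q²; q²)_k
x^{n-2k}`. -/
def qHermite (n : ℕ) (q x : ℝ) : ℝ :=
  ∑ k ∈ range (n / 2 + 1),
    (-1) ^ k *
      (qPoch (q ^ (-(n : ℤ))) (q ^ 2) k * qPoch (q ^ (-(n : ℤ) + 1)) (q ^ 2) k *
        q ^ (k * (2 * n - k)) / qPoch (q ^ 2) (q ^ 2) k) *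
      x ^ (n - 2 * k)

/-- The integrand `|x|^{2p} H_j(x; q)² ω(x) / ((1 - q) (q; q)_j q^{j(j-1)/2})`. -/
def momentIntegrand (q : ℝ) (p j : ℕ) (x : ℝ) : ℝ :=
  |x| ^ (2 * p) * qHermite j q x ^ 2 * weight q x /
    ((1 - q) * qPoch q q j * q ^ (j * (j - 1) / 2))

/-- The individual moment `𝔪_{2p,j}`. -/
def moment (q : ℝ) (p j : ℕ) : ℝ := jacksonIntegral q (momentIntegrand q p j) (-1) 1

/-- The scaled individual moment `(1 - q)^{-p} 𝔪_{2p,j}`. -/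
def scaledMoment (q : ℝ) (p j : ℕ) : ℝ := 1 / (1 - q) ^ p * moment q p j

/-- The one-point density of the discrete `q`-GUE with `N` eigenvalues. -/
def density (q : ℝ) (N : ℕ) (x : ℝ) : ℝ :=
  1 / (1 - q) *
    (∑ j ∈ range N, qHermite j q x ^ 2 / (qPoch q q j * q ^ (j * (j - 1) / 2))) * weight q x

/-- The scaled density `√(1-q) ρ_N(√(1-q) x)`. -/
def scaledDensity (q : ℝ) (N : ℕ) (x : ℝ) : ℝ :=
  Real.sqrt (1 - q) * density q N (Real.sqrt (1 - q) * x)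

/-- The scaled spectral moment of order `2p` of the discrete `q`-GUE with `N` eigenvalues:
the Jackson integral of `|x|^{2p}` against the scaled density over its support. -/
def scaledSpectralMoment (q : ℝ) (N p : ℕ) : ℝ :=
  jacksonIntegral q (fun x => |x| ^ (2 * p) * scaledDensity q N x)
    (-(1 / Real.sqrt (1 - q))) (1 / Real.sqrt (1 - q))

/-! ### The GUE -/

/-- The standard Gaussian weight. -/
def gaussianWeight (x : ℝ) : ℝ := Real.exp (-x ^ 2 / 2) / Real.sqrt (2 * Real.pi)

/-- The individual GUE moment `∫ x^{2p} He_j(x)² / j! · e^{-x²/2} / √(2π) dx`, where `He_j` is the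
probabilists' Hermite polynomial. -/
def gueMoment (p j : ℕ) : ℝ :=
  ∫ x : ℝ, x ^ (2 * p) *
    (Polynomial.aeval x (Polynomial.hermite j) ^ 2 / (Nat.factorial j : ℝ)) * gaussianWeight x

/-- The GUE spectral moment of order `2p` with `N` eigenvalues. -/
def gueSpectralMoment (N p : ℕ) : ℝ := ∑ j ∈ range N, gueMoment p j

end

end QGUE

/-! Both ensembles are instances of one two-parameter family. Let `P_n` be the monic polynomials
with Jacobi parameters `s q^n [n+1]_q`, and let `L` be a functional with `m_{n+2} = s [n+1]_q m_n`,
`m_0 = 1`, `m_1 = 0`. The moment recursion says `L (X f) = s L (D_q f)`; since `D_q P_{n+1} =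
[n+1]_q P_n`, the `P_n` are orthogonal for `L` (`map_monicPoly_mul`). Multiplication by `X` raises
or lowers the degree, so `X^n P_j` can be normal ordered (`X_pow_mul_monicPoly`): the term with `u`
raisings and `l` lowerings is a multiple of `P_{j-l+u}`, and its coefficient has a closed form
(`normalOrderCoeff_mul`). In `L (X^{2p} P_j^2)` orthogonality keeps only `u = l`, which leaves the
positive sum (`map_X_pow_mul_sq`). For `s = 1 - q` the family is the discrete `q`-Hermite one
(`eval_monicPoly`), and the Jackson integral gives such an `L` by a Pearson equation for the weight
and an evaluation of its total mass (`jacksonMoment_zero`). For `q = s = 1` it is the Hermite family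
with the Gaussian. The sum `momentSum` is written with `1 + q + ⋯ + q^{n-1}`, so it makes sense at
`q = 1`; the limit is then continuity in `q`. -/

namespace QGUE

open Finset Polynomial

noncomputable section

/-! ### `q`-integers, including `q = 1` -/

/-- The `q`-integer `1 + q + ⋯ + q^{n-1}`, meaningful at `q = 1` too. -/
def geomInt (q : ℝ) (n : ℕ) : ℝ := ∑ i ∈ range n, q ^ i

@[simp] lemma geomInt_zero (q : ℝ) : geomInt q 0 = 0 := by simp [geomInt]

@[simp] lemma geomInt_one (q : ℝ) : geomInt q 1 = 1 := by simp [geomInt]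

lemma geomInt_succ (q : ℝ) (n : ℕ) : geomInt q (n + 1) = geomInt q n + q ^ n :=
  sum_range_succ _ _

lemma geomInt_add (q : ℝ) (m n : ℕ) : geomInt q (m + n) = geomInt q m + q ^ m * geomInt q n := by
  simp [geomInt, sum_range_add, pow_add, mul_sum]

lemma one_sub_mul_geomInt (q : ℝ) (n : ℕ) : (1 - q) * geomInt q n = 1 - q ^ n := by
  rw [geomInt, mul_comm, geom_sum_mul_neg]

lemma geomInt_pos {q : ℝ} (hq : 0 < q) (n : ℕ) : 0 < geomInt q (n + 1) :=
  sum_pos (fun _ _ => by positivity) (by simp)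

lemma geomInt_one_left (n : ℕ) : geomInt 1 n = n := by simp [geomInt]

/-- The `q`-factorial built from `geomInt`. -/
def geomFactorial (q : ℝ) (n : ℕ) : ℝ := ∏ i ∈ range n, geomInt q (i + 1)

/-- The even `q`-double factorial `[2]_q [4]_q ⋯ [2n]_q`. -/
def geomEvenFactorial (q : ℝ) (n : ℕ) : ℝ := ∏ i ∈ range n, geomInt q (2 * i + 2)

/-- The falling `q`-factorial `[n]_q [n-1]_q ⋯ [n-k+1]_q`. -/
def geomDescFactorial (q : ℝ) (n k : ℕ) : ℝ := ∏ i ∈ range k, geomInt q (n - i)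

@[simp] lemma geomFactorial_zero (q : ℝ) : geomFactorial q 0 = 1 := by simp [geomFactorial]

lemma geomFactorial_succ (q : ℝ) (n : ℕ) :
    geomFactorial q (n + 1) = geomFactorial q n * geomInt q (n + 1) := prod_range_succ _ _

@[simp] lemma geomEvenFactorial_zero (q : ℝ) : geomEvenFactorial q 0 = 1 := by
  simp [geomEvenFactorial]

lemma geomEvenFactorial_succ (q : ℝ) (n : ℕ) :
    geomEvenFactorial q (n + 1) = geomEvenFactorial q n * geomInt q (2 * n + 2) :=
  prod_range_succ _ _

lemma geomDescFactorial_succ (q : ℝ) (n k : ℕ) :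
    geomDescFactorial q n (k + 1) = geomDescFactorial q n k * geomInt q (n - k) :=
  prod_range_succ _ _

lemma geomFactorial_pos {q : ℝ} (hq : 0 < q) (n : ℕ) : 0 < geomFactorial q n :=
  prod_pos fun _ _ => geomInt_pos hq _

lemma geomEvenFactorial_pos {q : ℝ} (hq : 0 < q) (n : ℕ) : 0 < geomEvenFactorial q n :=
  prod_pos fun i _ => geomInt_pos hq (2 * i + 1)

lemma geomDescFactorial_of_lt (q : ℝ) {n k : ℕ} (h : n < k) : geomDescFactorial q n k = 0 :=
  prod_eq_zero (mem_range.2 h) (by simp)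

lemma geomDescFactorial_mul (q : ℝ) {n k : ℕ} (h : k ≤ n) :
    geomDescFactorial q n k * geomFactorial q (n - k) = geomFactorial q n := by
  induction k with
  | zero => simp [geomDescFactorial]
  | succ k ih =>
    rw [geomDescFactorial_succ, ← ih (by omega), show n - k = n - (k + 1) + 1 by omega,
      geomFactorial_succ]
    ring

/-! ### The orthogonal polynomials with Jacobi parameters `s q^n [n+1]` -/

/-- The monic polynomials with `P_{n+2} = X P_{n+1} - s q^n [n+1]_q P_n`. -/
def monicPoly (q s : ℝ) : ℕ → ℝ[X]
  | 0 => 1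
  | 1 => X
  | n + 2 => X * monicPoly q s (n + 1) - (s * q ^ n * geomInt q (n + 1)) • monicPoly q s n

/-- The truncated `n - 1` is harmless at `n = 0`, where `[0]_q = 0` kills the last term. -/
lemma X_mul_monicPoly (q s : ℝ) (n : ℕ) :
    X * monicPoly q s n =
      monicPoly q s (n + 1) + (s * q ^ (n - 1) * geomInt q n) • monicPoly q s (n - 1) := by
  cases n with
  | zero => simp [monicPoly]
  | succ n => simp [monicPoly]

/-- The `q`-derivative, `X^n ↦ [n]_q X^{n-1}`. -/
def qDerivative (q : ℝ) : ℝ[X] →ₗ[ℝ] ℝ[X] :=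
  Polynomial.lsum fun n => geomInt q n • monomial (n - 1)

lemma qDerivative_monomial (q : ℝ) (n : ℕ) (a : ℝ) :
    qDerivative q (monomial n a) = geomInt q n • monomial (n - 1) a := by
  simp [qDerivative, Polynomial.lsum_apply]

/-- Twisted Leibniz rule; on monomials it is `[n+1] = 1 + q [n]`. -/
lemma qDerivative_X_mul (q : ℝ) (f : ℝ[X]) :
    qDerivative q (X * f) = f + q • (X * qDerivative q f) := by
  have : qDerivative q ∘ₗ LinearMap.mulLeft ℝ X =
      LinearMap.id + q • (LinearMap.mulLeft ℝ X ∘ₗ qDerivative q) := by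
    ext n : 2
    simp only [LinearMap.comp_apply, LinearMap.add_apply, LinearMap.smul_apply,
      LinearMap.mulLeft_apply, LinearMap.id_apply, X_mul_monomial, qDerivative_monomial]
    cases n with
    | zero => simp
    | succ n =>
      simp only [Nat.add_sub_cancel, mul_smul_comm, X_mul_monomial, smul_smul]
      rw [← one_smul ℝ (monomial (n + 1) 1 : ℝ[X]), smul_smul, smul_smul, ← add_smul,
        add_comm (n + 1) 1, geomInt_add q 1 (n + 1)]
      simp
  simpa using LinearMap.congr_fun this f

/-- Differentiate the recurrence and re-expand `X P_{n+1}`. The factor `q` of the Leibniz rule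
matches the ratio `q` of the powers in consecutive Jacobi parameters, so the lowest terms cancel. -/
lemma qDerivative_monicPoly_succ (q s : ℝ) (n : ℕ) :
    qDerivative q (monicPoly q s (n + 1)) = geomInt q (n + 1) • monicPoly q s n := by
  induction n using Nat.strong_induction_on with
  | _ n ih =>
  match n with
  | 0 => simp [monicPoly, ← monomial_one_one_eq_X, qDerivative_monomial]
  | 1 =>
    have h1 : qDerivative q (1 : ℝ[X]) = 0 := by
      simpa using qDerivative_monomial q 0 1
    have h := ih 0 (by omega)
    simp only [zero_add, geomInt_one, one_smul] at h
    have e : monicPoly q s (1 + 1) = X * X - (s * q ^ 0 * geomInt q (0 + 1)) • 1 := rfl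
    rw [show monicPoly q s 1 = X from rfl] at h ⊢
    rw [e, map_sub, map_smul, qDerivative_X_mul, h, h1]
    simp [monicPoly, geomInt_succ, add_smul]
  | n + 2 =>
    rw [monicPoly, map_sub, map_smul, qDerivative_X_mul, ih (n + 1) (by omega), ih n (by omega),
      mul_smul_comm, X_mul_monicPoly q s (n + 1), Nat.add_sub_cancel,
      show n + 1 + 1 + 1 = 1 + (n + 2) by ring, geomInt_add q 1 (n + 2)]
    simp only [smul_add, smul_smul, add_smul, geomInt_one, one_smul, pow_succ]
    module

/-! ### The moment functional -/

/-- A linear functional on polynomials whose moments are `m_0 = 1`, `m_1 = 0`,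
`m_{n+2} = s [n+1]_q m_n`. -/
structure IsMomentFunctional (q s : ℝ) (L : ℝ[X] →ₗ[ℝ] ℝ) : Prop where
  map_one : L 1 = 1
  map_X : L X = 0
  map_X_pow_add_two : ∀ n, L (X ^ (n + 2)) = s * geomInt q (n + 1) * L (X ^ n)

namespace IsMomentFunctional

variable {q s : ℝ} {L : ℝ[X] →ₗ[ℝ] ℝ}

/-- The analogue of Gaussian integration by parts; on monomials it is the moment recursion. -/
lemma map_X_mul (hL : IsMomentFunctional q s L) (f : ℝ[X]) :
    L (X * f) = s * L (qDerivative q f) := by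
  have : L ∘ₗ LinearMap.mulLeft ℝ X = s • (L ∘ₗ qDerivative q) := by
    ext n
    simp only [LinearMap.comp_apply, LinearMap.smul_apply, LinearMap.mulLeft_apply,
      X_mul_monomial, qDerivative_monomial, map_smul, smul_eq_mul]
    cases n with
    | zero => simpa [monomial_one_one_eq_X] using hL.map_X
    | succ n =>
      simp only [Nat.add_sub_cancel, ← X_pow_eq_monomial]
      rw [hL.map_X_pow_add_two, mul_assoc]
  simpa using LinearMap.congr_fun this f

lemma map_monicPoly_succ (hL : IsMomentFunctional q s L) (n : ℕ) :
    L (monicPoly q s (n + 1)) = 0 := by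
  induction n using Nat.strong_induction_on with
  | _ n ih =>
  match n with
  | 0 => simpa [monicPoly] using hL.map_X
  | n + 1 =>
    rw [monicPoly, map_sub, hL.map_X_mul, qDerivative_monicPoly_succ, map_smul, map_smul]
    -- The difference is a multiple of `L (P_n)`: for `n = 0` its two terms are equal, otherwise
    -- both vanish by induction.
    cases n with
    | zero => simp
    | succ n => simp [ih n (by omega)]

/-- Induction on `m`: a factor `X` is moved from the left polynomial to the right one, where the
recurrence applies again. -/
lemma map_monicPoly_mul (hL : IsMomentFunctional q s L) (m n : ℕ) :
    L (monicPoly q s m * monicPoly q s n) =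
      if m = n then ∏ i ∈ range n, s * q ^ i * geomInt q (i + 1) else 0 := by
  induction m using Nat.strong_induction_on generalizing n with
  | _ m ih =>
  match m with
  | 0 =>
    cases n with
    | zero => simp [monicPoly, hL.map_one]
    | succ n => simp [monicPoly, hL.map_monicPoly_succ]
  | m + 1 =>
    have h1 : monicPoly q s (m + 1) * monicPoly q s n =
        monicPoly q s m * (X * monicPoly q s n) -
          (s * q ^ (m - 1) * geomInt q m) • (monicPoly q s (m - 1) * monicPoly q s n) := by
      rw [← smul_mul_assoc, ← sub_eq_of_eq_add (X_mul_monicPoly q s m)]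
      ring
    rw [h1, X_mul_monicPoly, mul_add, mul_smul_comm, map_sub, map_add, map_smul, map_smul,
      ih m (by omega), ih m (by omega), smul_eq_mul, smul_eq_mul]
    rcases m with _ | m
    · rcases n with _ | _ | n <;> simp
    · rw [ih (m + 1 - 1) (by omega)]
      rcases n with _ | n
      · rcases m with _ | m <;> simp
      · simp only [Nat.add_sub_cancel, add_left_inj]
        -- For `m = n + 1` the raising term on the right cancels the lowering term on the left. For
        -- `m + 1 = n`, the diagonal, only the lowering term on the right survives.
        by_cases h : m = n + 1
        · subst h
          simp [prod_range_succ, mul_comm]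
        · by_cases h' : m + 1 = n
          · subst h'
            rw [if_pos rfl, if_neg (by omega), if_neg h, if_pos rfl, prod_range_succ _ (m + 1)]
            simp [mul_comm]
          · simp [h, h']

end IsMomentFunctional

end

end QGUE

namespace QGUE

open Finset Polynomial

noncomputable section

/-! ### Normal ordering: expansion of `X^n P_j` in the orthogonal polynomials -/

/-- The coefficient of "`u` raising and `l` lowering operators" in the normal ordering of the
`n`-th power of the multiplication operator by `X`. -/
def normalOrderCoeff (q s : ℝ) : ℕ → ℕ → ℕ → ℝ
  | 0, u, l => if u = 0 ∧ l = 0 then 1 else 0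
  | n + 1, u, l =>
    (if u = 0 then 0 else normalOrderCoeff q s n (u - 1) l) +
      (if l = 0 then 0 else s * q ^ n * normalOrderCoeff q s n u (l - 1)) +
      s * q ^ u * geomInt q (u + 1) * normalOrderCoeff q s n (u + 1) l

lemma normalOrderCoeff_of_lt (q s : ℝ) {n u l : ℕ} (h : n < u + l) :
    normalOrderCoeff q s n u l = 0 := by
  induction n generalizing u l with
  | zero =>
    rw [normalOrderCoeff, if_neg (by omega)]
  | succ n ih =>
    rw [normalOrderCoeff, ih (u := u + 1) (by omega), mul_zero, add_zero]
    have h1 : (if u = 0 then 0 else normalOrderCoeff q s n (u - 1) l) = 0 := by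
      split_ifs with hu
      · rfl
      · exact ih (by omega)
    have h2 : (if l = 0 then 0 else s * q ^ n * normalOrderCoeff q s n u (l - 1)) = 0 := by
      split_ifs with hl
      · rfl
      · rw [ih (by omega), mul_zero]
    rw [h1, h2, add_zero]

/-- Here `i` counts contracted pairs. Up to the common factor `R`, the three terms of the recursion
contribute `[u]`, `q^{u+2i} [l]` and `q^u [2i]`, which add up to `[u + 2i + l]`. -/
lemma normalOrderCoeff_mul (q s : ℝ) (u l i : ℕ) :
    normalOrderCoeff q s (u + l + 2 * i) u l *
        (geomEvenFactorial q i * geomFactorial q u * geomFactorial q l) =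
      s ^ (l + i) * q ^ l.choose 2 * geomFactorial q (u + l + 2 * i) := by
  induction hn : u + l + 2 * i generalizing u l i with
  | zero =>
    obtain ⟨rfl, rfl, rfl⟩ : u = 0 ∧ l = 0 ∧ i = 0 := by omega
    simp [normalOrderCoeff]
  | succ n ih =>
    set R := s ^ (l + i) * q ^ l.choose 2 * geomFactorial q n with hR
    set W := geomEvenFactorial q i * geomFactorial q u * geomFactorial q l with hW
    have h1 : (if u = 0 then 0 else normalOrderCoeff q s n (u - 1) l) * W =
        R * geomInt q u := by
      rcases u with _ | u
      · simp
      · rw [hR, ← ih u l i (by omega), hW, geomFactorial_succ]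
        simp only [Nat.add_sub_cancel, Nat.succ_ne_zero, if_false]
        ring
    have h2 : (if l = 0 then 0 else s * q ^ n * normalOrderCoeff q s n u (l - 1)) * W =
        R * (q ^ (u + 2 * i) * geomInt q l) := by
      rcases l with _ | l
      · simp
      · have h := ih u l i (by omega)
        have hc : (l + 1).choose 2 = l.choose 2 + l := by
          rw [Nat.choose_succ_succ' l 1, Nat.choose_one_right, add_comm]
        have hn' : n = l + (u + 2 * i) := by omega
        simp only [Nat.add_sub_cancel, Nat.succ_ne_zero, if_false]
        rw [hW, geomFactorial_succ, hR, hc]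
        have hq : q ^ n = q ^ l * q ^ (u + 2 * i) := by rw [hn', pow_add]
        rw [hq, pow_add q (l.choose 2) l, show l + 1 + i = l + i + 1 by ring, pow_succ]
        linear_combination s * q ^ l * q ^ (u + 2 * i) * geomInt q (l + 1) * h
    have h3 : s * q ^ u * geomInt q (u + 1) * normalOrderCoeff q s n (u + 1) l * W =
        R * (q ^ u * geomInt q (2 * i)) := by
      rcases i with _ | i
      · rw [normalOrderCoeff_of_lt q s (by omega)]
        simp
      · have h := ih (u + 1) l i (by omega)
        rw [geomFactorial_succ] at h
        rw [hW, geomEvenFactorial_succ, hR, ← add_assoc, pow_succ,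
          show 2 * (i + 1) = 2 * i + 2 by ring]
        linear_combination s * q ^ u * geomInt q (2 * i + 2) * h
    have h4 : geomInt q (n + 1) =
        geomInt q u + (q ^ (u + 2 * i) * geomInt q l) + q ^ u * geomInt q (2 * i) := by
      rw [← hn, show u + l + 2 * i = u + (2 * i + l) by ring, geomInt_add, geomInt_add]
      ring
    rw [normalOrderCoeff, add_mul, add_mul, h1, h2, h3, geomFactorial_succ, h4, hR]
    ring

/-- The term of `X^n P_j` with `u` raising and `l` lowering operators. -/
def normalOrderTerm (q s : ℝ) (j n u l : ℕ) : ℝ[X] :=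
  (normalOrderCoeff q s n u l * geomDescFactorial q j l * q ^ ((j - l) * (n - u))) •
    monicPoly q s (j - l + u)

/-- With `d = j - l`, split the lowering coefficient by `[d + u] = [d] + q^d [u]`: the first part is
a new lowering of `P_j`, the second contracts with one of the `u` raisings. -/
lemma X_mul_normalOrderTerm (q s : ℝ) (j n u l : ℕ) :
    X * normalOrderTerm q s j n u l =
      (normalOrderCoeff q s n u l * geomDescFactorial q j l * q ^ ((j - l) * (n - u))) •
          monicPoly q s (j - l + (u + 1)) +
      (s * q ^ n * normalOrderCoeff q s n u l * geomDescFactorial q j (l + 1) *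
          q ^ ((j - (l + 1)) * (n + 1 - u))) • monicPoly q s (j - (l + 1) + u) +
      (s * q ^ (u - 1) * geomInt q u * normalOrderCoeff q s n u l * geomDescFactorial q j l *
          q ^ ((j - l) * (n + 2 - u))) • monicPoly q s (j - l + (u - 1)) := by
  rcases lt_or_ge n u with hnu | hnu
  · simp [normalOrderTerm, normalOrderCoeff_of_lt q s (show n < u + l by omega)]
  obtain ⟨k, rfl⟩ := Nat.exists_eq_add_of_le hnu
  rw [normalOrderTerm, mul_smul_comm, X_mul_monicPoly, geomInt_add, smul_add, smul_smul,
    geomDescFactorial_succ, add_assoc (_ • _) (_ • _), add_assoc (j - l) u 1]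
  congr 1
  rw [show j - (l + 1) = j - l - 1 by omega]
  generalize j - l = d
  rw [show u + k - u = k by omega, show u + k + 1 - u = k + 1 by omega,
    show u + k + 2 - u = k + 2 by omega]
  rcases d with _ | d
  · simp
    module
  · rw [show d + 1 + u - 1 = d + u by omega, Nat.add_sub_cancel]
    rcases u with _ | u
    · simp only [geomInt_zero, add_zero, mul_zero, zero_mul, zero_smul, zero_add]
      ring_nf
    · rw [Nat.add_sub_cancel, show d + 1 + u = d + (u + 1) by ring, ← add_smul]
      congr 1
      ring

/-- The three parts of `X_mul_normalOrderTerm` become the three terms of the recursion after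
shifting `u` or `l` by one. Top boundary terms vanish because `n < M`; bottom ones vanish by the
`if`s or by `[0] = 0`. -/
lemma sum_normalOrderTerm_succ (q s : ℝ) (j n M : ℕ) (hM : n < M) :
    ∑ l ∈ range (M + 1), ∑ u ∈ range (M + 1), normalOrderTerm q s j (n + 1) u l =
      X * ∑ l ∈ range (M + 1), ∑ u ∈ range (M + 1), normalOrderTerm q s j n u l := by
  have hA (l : ℕ) : ∑ u ∈ range (M + 1),
      ((if u = 0 then 0 else normalOrderCoeff q s n (u - 1) l) * geomDescFactorial q j l *
        q ^ ((j - l) * (n + 1 - u))) • monicPoly q s (j - l + u) =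
      ∑ u ∈ range (M + 1), (normalOrderCoeff q s n u l * geomDescFactorial q j l *
        q ^ ((j - l) * (n - u))) • monicPoly q s (j - l + (u + 1)) := by
    conv_lhs => rw [sum_range_succ']
    conv_rhs => rw [sum_range_succ, normalOrderCoeff_of_lt q s (show n < M + l by omega)]
    simp
  have hB : ∑ l ∈ range (M + 1), ∑ u ∈ range (M + 1),
      ((if l = 0 then 0 else s * q ^ n * normalOrderCoeff q s n u (l - 1)) *
        geomDescFactorial q j l * q ^ ((j - l) * (n + 1 - u))) • monicPoly q s (j - l + u) =
      ∑ l ∈ range (M + 1), ∑ u ∈ range (M + 1),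
        (s * q ^ n * normalOrderCoeff q s n u l * geomDescFactorial q j (l + 1) *
          q ^ ((j - (l + 1)) * (n + 1 - u))) • monicPoly q s (j - (l + 1) + u) := by
    conv_lhs => rw [sum_range_succ']
    conv_rhs => rw [sum_range_succ]
    refine congrArg₂ (· + ·) ?_ ?_
    · refine sum_congr rfl fun l _ => sum_congr rfl fun u _ => ?_
      simp
    · rw [sum_eq_zero, sum_eq_zero]
      · intro u _
        rw [normalOrderCoeff_of_lt q s (by omega)]
        simp
      · simp
  have hC (l : ℕ) : ∑ u ∈ range (M + 1),
      (s * q ^ u * geomInt q (u + 1) * normalOrderCoeff q s n (u + 1) l *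
        geomDescFactorial q j l * q ^ ((j - l) * (n + 1 - u))) • monicPoly q s (j - l + u) =
      ∑ u ∈ range (M + 1), (s * q ^ (u - 1) * geomInt q u * normalOrderCoeff q s n u l *
        geomDescFactorial q j l * q ^ ((j - l) * (n + 2 - u))) •
          monicPoly q s (j - l + (u - 1)) := by
    conv_lhs => rw [sum_range_succ, normalOrderCoeff_of_lt q s (show n < M + 1 + l by omega)]
    conv_rhs => rw [sum_range_succ']
    simp
  simp_rw [mul_sum, X_mul_normalOrderTerm, sum_add_distrib, ← hA, ← hB, ← hC,
    ← sum_add_distrib, normalOrderTerm, normalOrderCoeff, add_mul, add_smul]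

lemma X_pow_mul_monicPoly (q s : ℝ) (j n M : ℕ) (hM : n < M) :
    X ^ n * monicPoly q s j =
      ∑ l ∈ range M, ∑ u ∈ range M, normalOrderTerm q s j n u l := by
  induction n generalizing M with
  | zero =>
    rw [sum_eq_single_of_mem 0 (by simpa using hM), sum_eq_single_of_mem 0 (by simpa using hM)]
    · simp [normalOrderTerm, normalOrderCoeff, geomDescFactorial]
    · intro u _ hu
      simp [normalOrderTerm, normalOrderCoeff, hu]
    · intro l _ hl
      simp [normalOrderTerm, normalOrderCoeff, hl]
  | succ n ih =>
    obtain ⟨M, rfl⟩ : ∃ k, M = k + 1 := ⟨M - 1, by omega⟩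
    rw [sum_normalOrderTerm_succ q s j n M (by omega), ← ih _ (by omega)]
    ring

/-- The closed form of the diagonal moments, as a function of `q` that is regular at `q = 1`. -/
def momentSum (q : ℝ) (p j : ℕ) : ℝ :=
  ∑ l ∈ range (p + 1), q ^ ((j - l) * (2 * p - l) + l.choose 2) *
    (geomDescFactorial q j l / geomFactorial q l) *
      (geomFactorial q (2 * p) / (geomEvenFactorial q (p - l) * geomFactorial q l))

lemma IsMomentFunctional.map_X_pow_mul_sq {q s : ℝ} {L : ℝ[X] →ₗ[ℝ] ℝ} (hq : 0 < q)
    (hL : IsMomentFunctional q s L) (p j : ℕ) :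
    L (X ^ (2 * p) * monicPoly q s j ^ 2) =
      s ^ p * momentSum q p j * (s ^ j * q ^ j.choose 2 * geomFactorial q j) := by
  have hnorm : ∏ i ∈ range j, s * q ^ i * geomInt q (i + 1) =
      s ^ j * q ^ j.choose 2 * geomFactorial q j := by
    induction j with
    | zero => simp
    | succ j ih =>
      rw [prod_range_succ, ih, geomFactorial_succ, Nat.choose_succ_succ' j 1,
        Nat.choose_one_right, pow_succ, pow_add]
      ring
  have hdiag (l : ℕ) : L ((∑ u ∈ range (2 * p + 1), normalOrderTerm q s j (2 * p) u l) *
      monicPoly q s j) = normalOrderCoeff q s (2 * p) l l * geomDescFactorial q j l *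
        q ^ ((j - l) * (2 * p - l)) * (s ^ j * q ^ j.choose 2 * geomFactorial q j) := by
    -- For `l > j` the truncated index `j - l + u` is meaningless, but the falling factorial is
    -- zero.
    rcases lt_or_ge j l with hl | hl
    · simp [normalOrderTerm, geomDescFactorial_of_lt q hl]
    rw [sum_mul, map_sum, sum_eq_single l]
    · rw [normalOrderTerm, smul_mul_assoc, map_smul, hL.map_monicPoly_mul,
        if_pos (by omega), hnorm, smul_eq_mul]
    · intro u _ hu
      rw [normalOrderTerm, smul_mul_assoc, map_smul, hL.map_monicPoly_mul,
        if_neg (by omega), smul_zero]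
    · intro h
      rw [mem_range] at h
      simp [normalOrderTerm, normalOrderCoeff_of_lt q s (show 2 * p < l + l by omega)]
  rw [pow_two, ← mul_assoc, X_pow_mul_monicPoly q s j (2 * p) (2 * p + 1) (by omega), sum_mul,
    map_sum, sum_congr rfl fun l _ => hdiag l, ← sum_mul]
  congr 1
  rw [← sum_subset (range_mono (show p + 1 ≤ 2 * p + 1 by omega)), momentSum, mul_sum]
  · refine sum_congr rfl fun l hl => ?_
    have hl : l ≤ p := by simpa [Nat.lt_succ_iff] using hl
    have h := normalOrderCoeff_mul q s l l (p - l)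
    rw [show l + l + 2 * (p - l) = 2 * p by omega, show l + (p - l) = p by omega] at h
    have h1 := (geomFactorial_pos hq l).ne'
    have h2 := (geomEvenFactorial_pos hq (p - l)).ne'
    rw [← eq_div_iff (by positivity)] at h
    rw [h, pow_add]
    field_simp
  -- For `l > p` the diagonal coefficient needs `2l > 2p` operators, so it is zero.
  · intro l _ hl
    rw [mem_range, not_lt] at hl
    rw [normalOrderCoeff_of_lt q s (by omega)]
    simp

end

end QGUE

namespace QGUE

open Finset Polynomial

noncomputable section

/-! ### Comparison with the `q`-notation and the discrete `q`-Hermite polynomials -/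

lemma qPoch_zero (a q : ℝ) : qPoch a q 0 = 1 := by simp [qPoch]

lemma qPoch_succ (a q : ℝ) (n : ℕ) : qPoch a q (n + 1) = qPoch a q n * (1 - a * q ^ n) :=
  prod_range_succ _ _

lemma qPoch_self_pos {q : ℝ} (hq0 : 0 < q) (hq1 : q < 1) (n : ℕ) : 0 < qPoch q q n :=
  prod_pos fun i _ => by
    rw [← pow_succ']
    exact sub_pos.2 (pow_lt_one₀ hq0.le hq1 (by omega))

lemma qInt_eq_geomInt {q : ℝ} (hq : q ≠ 1) (n : ℕ) : qInt q n = geomInt q n := by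
  rw [qInt, ← one_sub_mul_geomInt, mul_div_cancel_left₀ _ (sub_ne_zero.2 hq.symm)]

lemma qFactorial_eq_geomFactorial {q : ℝ} (hq : q ≠ 1) (n : ℕ) :
    qFactorial q n = geomFactorial q n :=
  prod_congr rfl fun _ _ => qInt_eq_geomInt hq _

lemma qDoubleFactorial_two_mul {q : ℝ} (hq : q ≠ 1) (n : ℕ) :
    qDoubleFactorial q (2 * n) = geomEvenFactorial q n := by
  induction n with
  | zero => simp [qDoubleFactorial]
  | succ n ih =>
    rw [show 2 * (n + 1) = 2 * n + 2 by ring, qDoubleFactorial, ih, geomEvenFactorial_succ,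
      qInt_eq_geomInt hq, mul_comm]

lemma qBinom_eq_geomDescFactorial_div {q : ℝ} (hq0 : 0 < q) (hq : q ≠ 1) (n k : ℕ) :
    qBinom q n k = geomDescFactorial q n k / geomFactorial q k := by
  rw [qBinom]
  split_ifs with h
  · simp only [qFactorial_eq_geomFactorial hq]
    rw [← geomDescFactorial_mul q h]
    have := (geomFactorial_pos hq0 (n - k)).ne'
    have := (geomFactorial_pos hq0 k).ne'
    field_simp
  · rw [geomDescFactorial_of_lt q (by omega), zero_div]

lemma qPoch_self_eq (q : ℝ) (n : ℕ) : qPoch q q n = (1 - q) ^ n * geomFactorial q n := by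
  induction n with
  | zero => simp [qPoch]
  | succ n ih =>
    rw [qPoch_succ, ih, geomFactorial_succ, ← pow_succ', ← one_sub_mul_geomInt]
    ring

lemma momentSum_eq {q : ℝ} (hq0 : 0 < q) (hq : q ≠ 1) (p j : ℕ) :
    momentSum q p j = ∑ l ∈ range (p + 1),
      q ^ (((j : ℤ) - l) * (2 * p - l) + (l : ℤ) * (l - 1) / 2) * qBinom q j l *
        (qFactorial q (2 * p) / (qDoubleFactorial q (2 * p - 2 * l) * qFactorial q l)) := by
  refine sum_congr rfl fun l hl => ?_
  have hl : l ≤ p := by simpa [Nat.lt_succ_iff] using hl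
  rw [← Nat.mul_sub, qDoubleFactorial_two_mul hq, qFactorial_eq_geomFactorial hq,
    qFactorial_eq_geomFactorial hq, qBinom_eq_geomDescFactorial_div hq0 hq]
  -- The natural and integer exponents can differ when `j < l`, but there both sides carry a zero
  -- factor.
  rcases lt_or_ge j l with h | h
  · simp [geomDescFactorial_of_lt q h]
  · congr 2
    rw [← zpow_natCast]
    congr 1
    have hc : (l : ℤ) * (l - 1) / 2 = (l.choose 2 : ℕ) := by
      rw [Nat.choose_two_right]
      rcases l with _ | l
      · simp
      · push_cast
        simp
    rw [hc]
    push_cast [Nat.cast_sub h, Nat.cast_sub (show l ≤ 2 * p by omega)]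
    ring

/-- The coefficient of `x^{n-2k}` in the discrete `q`-Hermite polynomial of degree `n`. -/
def qHermiteCoeff (q : ℝ) (n k : ℕ) : ℝ :=
  if 2 * k ≤ n then
    (-1) ^ k * q ^ (k * (k - 1)) * qPoch q q n / (qPoch q q (n - 2 * k) * qPoch (q ^ 2) (q ^ 2) k)
  else 0

/-- The two symbols interlace into `(q^{-n}; q)_{2k}`; clearing negative powers turns it into `(q;
q)_n / (q; q)_{n-2k}` up to a power of `q`. -/
lemma qPoch_zpow_mul {q : ℝ} (hq0 : 0 < q) {n k : ℕ} (h : 2 * k ≤ n) :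
    qPoch (q ^ (-(n : ℤ))) (q ^ 2) k * qPoch (q ^ (-(n : ℤ) + 1)) (q ^ 2) k *
      q ^ (k * (2 * n - k)) * qPoch q q (n - 2 * k) = q ^ (k * (k - 1)) * qPoch q q n := by
  induction k with
  | zero => simp [qPoch]
  | succ k ih =>
    obtain ⟨m, rfl⟩ := Nat.exists_eq_add_of_le h
    have ih := ih (by omega)
    have hq := hq0.ne'
    rw [show 2 * (k + 1) + m - 2 * k = m + 1 + 1 by omega, qPoch_succ, qPoch_succ] at ih
    rw [show 2 * (k + 1) + m - 2 * (k + 1) = m by omega, qPoch_succ, qPoch_succ]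
    have e1 : (k + 1) * (2 * (2 * (k + 1) + m) - (k + 1)) =
        k * (2 * (2 * (k + 1) + m) - k) + (2 * k + 2 * m + 3) := by
      rw [show 2 * (2 * (k + 1) + m) - (k + 1) = 3 * k + 2 * m + 3 by omega,
        show 2 * (2 * (k + 1) + m) - k = 3 * k + 2 * m + 4 by omega]
      ring
    have e2 : (k + 1) * (k + 1 - 1) = k * (k - 1) + 2 * k := by
      rcases k with _ | k
      · rfl
      · simp only [Nat.add_sub_cancel]
        ring
    have e3 : (1 - q ^ (-((2 * (k + 1) + m : ℕ) : ℤ)) * (q ^ 2) ^ k) *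
        (1 - q ^ (-((2 * (k + 1) + m : ℕ) : ℤ) + 1) * (q ^ 2) ^ k) * q ^ (2 * k + 2 * m + 3) =
        q ^ (2 * k) * ((1 - q * q ^ m) * (1 - q * q ^ (m + 1))) := by
      have a1 : q ^ (-((2 * (k + 1) + m : ℕ) : ℤ)) * (q ^ 2) ^ k = (q ^ (m + 2))⁻¹ := by
        rw [zpow_neg, zpow_natCast]
        field_simp
        ring
      have a2 : q ^ (-((2 * (k + 1) + m : ℕ) : ℤ) + 1) * (q ^ 2) ^ k = (q ^ (m + 1))⁻¹ := by
        rw [zpow_add₀ hq, mul_right_comm, a1, zpow_one, pow_succ q (m + 1)]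
        field_simp
      rw [a1, a2]
      field_simp
      ring
    rw [e1, e2, pow_add, pow_add]
    linear_combination q ^ (2 * k) * ih +
      qPoch (q ^ (-((2 * (k + 1) + m : ℕ) : ℤ))) (q ^ 2) k *
      qPoch (q ^ (-((2 * (k + 1) + m : ℕ) : ℤ) + 1)) (q ^ 2) k *
      q ^ (k * (2 * (2 * (k + 1) + m) - k)) * qPoch q q m * e3

/-- The free upper limit lets polynomials of different degrees be compared over aligned ranges. -/
lemma qHermite_eq_sum {q : ℝ} (hq0 : 0 < q) (hq1 : q < 1) (x : ℝ) {n M : ℕ} (hM : n / 2 < M) :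
    qHermite n q x = ∑ k ∈ range M, qHermiteCoeff q n k * x ^ (n - 2 * k) := by
  rw [← sum_subset (range_mono (show n / 2 + 1 ≤ M by omega)), qHermite]
  · refine sum_congr rfl fun k hk => ?_
    rw [mem_range] at hk
    have hk : 2 * k ≤ n := by omega
    rw [qHermiteCoeff, if_pos hk, mul_assoc _ _ (qPoch q q n), ← qPoch_zpow_mul hq0 hk]
    have := (qPoch_self_pos hq0 hq1 (n - 2 * k)).ne'
    congr 1
    rw [mul_comm (qPoch q q (n - 2 * k)), ← mul_assoc ((-1 : ℝ) ^ k), mul_div_mul_right _ _ this]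
    ring
  · intro k _ hk
    rw [mem_range, not_lt] at hk
    rw [qHermiteCoeff, if_neg (by omega), zero_mul]

lemma qHermiteCoeff_zero {q : ℝ} (hq0 : 0 < q) (hq1 : q < 1) (n : ℕ) :
    qHermiteCoeff q n 0 = 1 := by
  have := (qPoch_self_pos hq0 hq1 n).ne'
  simp [qHermiteCoeff, qPoch_zero, this]

/-- With `n = 2k + m` and common factors removed, this is `q^{2k} (1 - q^{n+2}) = q^{2k} (1 - q^m) +
q^n (1 - q^{2k+2})`. -/
lemma qHermiteCoeff_add_two {q : ℝ} (hq0 : 0 < q) (hq1 : q < 1) (n k : ℕ) :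
    qHermiteCoeff q (n + 2) (k + 1) =
      qHermiteCoeff q (n + 1) (k + 1) - q ^ n * (1 - q ^ (n + 1)) * qHermiteCoeff q n k := by
  rcases lt_or_ge n (2 * k) with h | h
  · rw [qHermiteCoeff, qHermiteCoeff, qHermiteCoeff, if_neg (by omega), if_neg (by omega),
      if_neg (by omega)]
    simp
  obtain ⟨m, rfl⟩ := Nat.exists_eq_add_of_le h
  have hq2 : 0 < q ^ 2 := by positivity
  have hq2' : q ^ 2 < 1 := pow_lt_one₀ hq0.le hq1 (by norm_num)
  have p1 := (qPoch_self_pos hq2 hq2' k).ne'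
  have p2 := (qPoch_self_pos hq2 hq2' (k + 1)).ne'
  have p3 := (qPoch_self_pos hq0 hq1 m).ne'
  have e : (k + 1) * (k + 1 - 1) = k * (k - 1) + 2 * k := by
    rcases k with _ | k
    · rfl
    · simp only [Nat.add_sub_cancel]
      ring
  rw [qHermiteCoeff, qHermiteCoeff, qHermiteCoeff, if_pos (show 2 * (k + 1) ≤ 2 * k + m + 2 by omega),
    if_pos (show 2 * k ≤ 2 * k + m by omega), e,
    show 2 * k + m + 2 - 2 * (k + 1) = m by omega, show 2 * k + m - 2 * k = m by omega,
    qPoch_succ q q (2 * k + m + 1), qPoch_succ q q (2 * k + m)]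
  rw [qPoch_succ (q ^ 2)] at p2 ⊢
  have p4 := right_ne_zero_of_mul p2
  rcases m with _ | m
  · rw [if_neg (show ¬ 2 * (k + 1) ≤ 2 * k + 0 + 1 by omega), pow_add, pow_succ (-1 : ℝ)]
    field_simp
    ring
  · rw [if_pos (show 2 * (k + 1) ≤ 2 * k + (m + 1) + 1 by omega),
      show 2 * k + (m + 1) + 1 - 2 * (k + 1) = m by omega]
    rw [qPoch_succ] at p3 ⊢
    have p5 := right_ne_zero_of_mul p3
    have p6 := left_ne_zero_of_mul p3
    rw [pow_add, pow_succ (-1 : ℝ)]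
    field_simp
    ring

lemma qHermite_add_two {q : ℝ} (hq0 : 0 < q) (hq1 : q < 1) (x : ℝ) (n : ℕ) :
    qHermite (n + 2) q x =
      x * qHermite (n + 1) q x - q ^ n * (1 - q ^ (n + 1)) * qHermite n q x := by
  rw [qHermite_eq_sum hq0 hq1 x (show (n + 2) / 2 < n + 1 + 1 by omega),
    qHermite_eq_sum hq0 hq1 x (show (n + 1) / 2 < n + 1 + 1 by omega),
    qHermite_eq_sum hq0 hq1 x (show n / 2 < n + 1 by omega),
    sum_range_succ', sum_range_succ' _ (n + 1), mul_add, mul_sum, mul_sum,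
    qHermiteCoeff_zero hq0 hq1, qHermiteCoeff_zero hq0 hq1, add_sub_right_comm,
    ← sum_sub_distrib]
  congr 1
  · refine sum_congr rfl fun k _ => ?_
    rw [qHermiteCoeff_add_two hq0 hq1, show n + 2 - 2 * (k + 1) = n - 2 * k by omega, sub_mul]
    congr 1
    -- Past this bound the truncated exponents disagree, but the coefficient vanishes.
    · rcases le_or_gt (2 * (k + 1)) (n + 1) with h | h
      · rw [show n - 2 * k = n + 1 - 2 * (k + 1) + 1 by omega]
        ring
      · rw [qHermiteCoeff, if_neg (by omega)]
        simp
    · ring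
  · simp
    ring

lemma eval_monicPoly {q : ℝ} (hq0 : 0 < q) (hq1 : q < 1) (n : ℕ) (x : ℝ) :
    (monicPoly q (1 - q) n).eval x = qHermite n q x := by
  induction n using Nat.strong_induction_on with
  | _ n ih =>
  match n with
  | 0 => simp [monicPoly, qHermite, qPoch]
  | 1 => simp [monicPoly, qHermite, qPoch]
  | n + 2 =>
    rw [qHermite_add_two hq0 hq1, monicPoly, eval_sub, eval_mul, eval_X, eval_smul,
      ih n (by omega), ih (n + 1) (by omega), smul_eq_mul, ← one_sub_mul_geomInt]
    ring

end

end QGUE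

namespace QGUE

open Finset Polynomial Filter Topology

noncomputable section

/-! ### Infinite `q`-Pochhammer symbols -/

lemma summable_mul_pow (a : ℝ) {q : ℝ} (hq0 : 0 < q) (hq1 : q < 1) :
    Summable fun l : ℕ => ‖-(a * q ^ l)‖ := by
  simp only [norm_neg, norm_mul, norm_pow, Real.norm_of_nonneg hq0.le]
  exact (summable_geometric_of_lt_one hq0.le hq1).mul_left _

lemma multipliable_qPochInf (a : ℝ) {q : ℝ} (hq0 : 0 < q) (hq1 : q < 1) :
    Multipliable fun l : ℕ => 1 - a * q ^ l := by
  simpa [sub_eq_add_neg] using multipliable_one_add_of_summable (summable_mul_pow a hq0 hq1)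

lemma qPochInf_ne_zero {a q : ℝ} (hq0 : 0 < q) (hq1 : q < 1) (ha : a < 1) :
    qPochInf a q ≠ 0 := by
  have h := tprod_one_add_ne_zero_of_summable (f := fun l : ℕ => -(a * q ^ l)) ?_
    (summable_mul_pow a hq0 hq1)
  · simpa [qPochInf, sub_eq_add_neg] using h
  · intro l
    have h1 : q ^ l ≤ 1 := pow_le_one₀ hq0.le hq1.le
    have h2 : 0 < q ^ l := pow_pos hq0 l
    have : a * q ^ l < 1 := by nlinarith
    linarith

lemma qPochInf_eq_mul (a : ℝ) {q : ℝ} (hq0 : 0 < q) (hq1 : q < 1) :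
    qPochInf a q = (1 - a) * qPochInf (a * q) q := by
  have h : (fun l : ℕ => 1 - a * q ^ (l + 1)) = fun l : ℕ => 1 - a * q * q ^ l := by
    funext l
    ring
  have := multipliable_qPochInf (a * q) hq0 hq1
  rw [qPochInf, tprod_eq_zero_mul' (by rwa [h]), h, qPochInf]
  simp

lemma qPochInf_mul_qPochInf_neg (a : ℝ) {q : ℝ} (hq0 : 0 < q) (hq1 : q < 1) :
    qPochInf a q * qPochInf (-a) q = qPochInf (a ^ 2) (q ^ 2) := by
  rw [qPochInf, qPochInf, ← (multipliable_qPochInf a hq0 hq1).tprod_mul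
    (multipliable_qPochInf (-a) hq0 hq1), qPochInf]
  congr 1
  funext l
  ring

lemma qPochInf_eq_even_mul_odd (a : ℝ) {q : ℝ} (hq0 : 0 < q) (hq1 : q < 1) :
    qPochInf a q = qPochInf a (q ^ 2) * qPochInf (a * q) (q ^ 2) := by
  have hq2 : 0 < q ^ 2 := by positivity
  have hq2' : q ^ 2 < 1 := pow_lt_one₀ hq0.le hq1 (by norm_num)
  have he : (fun k : ℕ => 1 - a * q ^ (2 * k)) = fun k : ℕ => 1 - a * (q ^ 2) ^ k := by
    funext k
    rw [pow_mul]
  have ho : (fun k : ℕ => 1 - a * q ^ (2 * k + 1)) = fun k : ℕ => 1 - a * q * (q ^ 2) ^ k := by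
    funext k
    rw [pow_succ, pow_mul]
    ring
  have h := tprod_even_mul_odd (f := fun l : ℕ => 1 - a * q ^ l)
    (by rw [he]; exact multipliable_qPochInf a hq2 hq2')
    (by rw [ho]; exact multipliable_qPochInf (a * q) hq2 hq2')
  rw [he, ho] at h
  exact h.symm

/-- Euler's identity `(-q; q)_∞ (q; q²)_∞ = 1`. -/
lemma qPochInf_neg_mul_qPochInf_sq {q : ℝ} (hq0 : 0 < q) (hq1 : q < 1) :
    qPochInf (-q) q * qPochInf q (q ^ 2) = 1 := by
  have h1 := qPochInf_eq_even_mul_odd q hq0 hq1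
  have h2 := qPochInf_mul_qPochInf_neg q hq0 hq1
  have h3 := qPochInf_ne_zero hq0 hq1 hq1
  -- Both splittings contain `(q²; q²)_∞`; eliminating it leaves the claim times `(q; q)_∞`.
  rw [← pow_two, ← h2] at h1
  refine mul_left_cancel₀ h3 ?_
  linear_combination -h1

lemma qPochInf_mem_Icc {a q : ℝ} (hq0 : 0 < q) (hq1 : q < 1) (ha0 : 0 ≤ a) (ha1 : a ≤ 1) :
    qPochInf a q ∈ Set.Icc 0 1 := by
  refine isClosed_Icc.mem_of_tendsto
    (multipliable_qPochInf a hq0 hq1).hasProd.tendsto_prod_nat (Eventually.of_forall fun n => ?_)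
  have h (i : ℕ) : 0 ≤ a * q ^ i ∧ a * q ^ i ≤ 1 :=
    ⟨by positivity, mul_le_one₀ ha1 (by positivity) (pow_le_one₀ hq0.le hq1.le)⟩
  exact ⟨prod_nonneg fun i _ => sub_nonneg.2 (h i).2,
    prod_le_one (fun i _ => sub_nonneg.2 (h i).2) fun i _ => sub_le_self _ (h i).1⟩

/-! ### Moments of the discrete `q`-Hermite weight -/

/-- The numerator `(q^{k+1}, -q^{k+1}; q)_∞` of the weight at `x = ±q^k`. -/
def weightNum (q : ℝ) (k : ℕ) : ℝ := qPochInf (q * q ^ k) q * qPochInf (-(q * q ^ k)) q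

/-- The Pearson equation of the weight, source of the moment recursion. -/
lemma weightNum_eq_mul_succ {q : ℝ} (hq0 : 0 < q) (hq1 : q < 1) (k : ℕ) :
    weightNum q k = (1 - (q ^ (k + 1)) ^ 2) * weightNum q (k + 1) := by
  rw [weightNum, weightNum, qPochInf_eq_mul _ hq0 hq1, qPochInf_eq_mul (-(q * q ^ k)) hq0 hq1,
    show q * q ^ k * q = q * q ^ (k + 1) by ring,
    show -(q * q ^ k) * q = -(q * q ^ (k + 1)) by ring]
  ring

lemma weightNum_mem_Icc {q : ℝ} (hq0 : 0 < q) (hq1 : q < 1) (k : ℕ) :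
    weightNum q k ∈ Set.Icc 0 1 := by
  rw [weightNum, qPochInf_mul_qPochInf_neg _ hq0 hq1, ← pow_succ']
  exact qPochInf_mem_Icc (by positivity) (pow_lt_one₀ hq0.le hq1 (by norm_num)) (by positivity)
    (pow_le_one₀ (by positivity) (pow_le_one₀ hq0.le hq1.le))

lemma norm_weightNum_le {q : ℝ} (hq0 : 0 < q) (hq1 : q < 1) (k : ℕ) : ‖weightNum q k‖ ≤ 1 := by
  have h := weightNum_mem_Icc hq0 hq1 k
  rw [Real.norm_of_nonneg h.1]
  exact h.2

/-- The one-sided unnormalised moments of the discrete `q`-Hermite weight. -/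
def jacksonMoment (q : ℝ) (n : ℕ) : ℝ := ∑' k : ℕ, (q ^ k) ^ (n + 1) * weightNum q k

lemma summable_jacksonMoment {q : ℝ} (hq0 : 0 < q) (hq1 : q < 1) (n : ℕ) :
    Summable fun k : ℕ => (q ^ k) ^ (n + 1) * weightNum q k := by
  refine (summable_geometric_of_lt_one hq0.le hq1).of_norm_bounded fun k => ?_
  rw [norm_mul, Real.norm_of_nonneg (by positivity)]
  have h1 : (q ^ k) ^ (n + 1) ≤ q ^ k :=
    pow_le_of_le_one (by positivity) (pow_le_one₀ hq0.le hq1.le) (by omega)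
  exact (mul_le_of_le_one_right (by positivity) (norm_weightNum_le hq0 hq1 k)).trans h1

lemma jacksonMoment_add_two {q : ℝ} (hq0 : 0 < q) (hq1 : q < 1) (n : ℕ) :
    jacksonMoment q (n + 2) = (1 - q ^ (n + 1)) * jacksonMoment q n := by
  have h := summable_jacksonMoment hq0 hq1 n
  have h2 := summable_jacksonMoment hq0 hq1 (n + 2)
  have e : q ^ (n + 1) * jacksonMoment q n =
      jacksonMoment q n - jacksonMoment q (n + 2) := by
    -- The difference has the factor `1 - q^{2k}`, which vanishes at `k = 0`; shifting `k` and using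
    -- the Pearson equation returns the original series times `q^{n+1}`.
    rw [jacksonMoment, jacksonMoment, ← h.tsum_sub h2, (h.sub h2).tsum_eq_zero_add, ← tsum_mul_left]
    simp only [pow_zero, one_pow, sub_self, zero_add]
    refine tsum_congr fun k => ?_
    rw [weightNum_eq_mul_succ hq0 hq1 k]
    ring
  linear_combination e

lemma jacksonMoment_two_mul {q : ℝ} (hq0 : 0 < q) (hq1 : q < 1) (n : ℕ) :
    jacksonMoment q (2 * n) = (∏ i ∈ range n, (1 - q * (q ^ 2) ^ i)) * jacksonMoment q 0 := by
  induction n with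
  | zero => simp
  | succ n ih =>
    rw [show 2 * (n + 1) = 2 * n + 2 by ring, jacksonMoment_add_two hq0 hq1, ih, prod_range_succ,
      pow_succ, pow_mul]
    ring

/-- High powers concentrate the sum on the node `x = 1`. -/
lemma tendsto_jacksonMoment {q : ℝ} (hq0 : 0 < q) (hq1 : q < 1) :
    Tendsto (fun n => jacksonMoment q (2 * n)) atTop (𝓝 (weightNum q 0)) := by
  have h : ∑' k : ℕ, (if k = 0 then weightNum q 0 else 0) = weightNum q 0 := tsum_ite_eq 0 _
  rw [← h]
  refine tendsto_tsum_of_dominated_convergence (bound := fun k => q ^ k)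
    (summable_geometric_of_lt_one hq0.le hq1) (fun k => ?_) (Eventually.of_forall fun n k => ?_)
  · rcases k with _ | k
    · simp
    · have hk : Tendsto (fun n => (q ^ (k + 1)) ^ n) atTop (𝓝 0) :=
        tendsto_pow_atTop_nhds_zero_of_lt_one (by positivity)
          (pow_lt_one₀ hq0.le hq1 (by omega))
      have hn : Tendsto (fun n : ℕ => 2 * n + 1) atTop atTop :=
        tendsto_atTop_mono (fun n : ℕ => show n ≤ 2 * n + 1 by omega) tendsto_id
      simpa using (hk.comp hn).mul_const (weightNum q (k + 1))
  · rw [norm_mul, Real.norm_of_nonneg (by positivity)]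
    have h1 : (q ^ k) ^ (2 * n + 1) ≤ q ^ k :=
      pow_le_of_le_one (by positivity) (pow_le_one₀ hq0.le hq1.le) (by omega)
    exact (mul_le_of_le_one_right (by positivity) (norm_weightNum_le hq0 hq1 k)).trans h1

/-- The normalisation of the discrete `q`-Hermite weight. -/
lemma jacksonMoment_zero {q : ℝ} (hq0 : 0 < q) (hq1 : q < 1) :
    jacksonMoment q 0 = qPochInf q q * qPochInf (-q) q ^ 2 := by
  have hq2 : 0 < q ^ 2 := by positivity
  have hq2' : q ^ 2 < 1 := pow_lt_one₀ hq0.le hq1 (by norm_num)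
  -- The moments `m_{2n} = (q; q²)_n m_0` have two expressions for their limit; equating them gives
  -- `(q; q²)_∞ m_0 = (q, -q; q)_∞`, and Euler's identity inverts `(q; q²)_∞`.
  have h1 := (multipliable_qPochInf q hq2 hq2').hasProd.tendsto_prod_nat.mul_const
    (jacksonMoment q 0)
  simp only [← jacksonMoment_two_mul hq0 hq1] at h1
  have h2 : qPochInf q (q ^ 2) * jacksonMoment q 0 = qPochInf q q * qPochInf (-q) q := by
    simpa [weightNum, qPochInf] using tendsto_nhds_unique h1 (tendsto_jacksonMoment hq0 hq1)
  linear_combination qPochInf (-q) q * h2 -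
    jacksonMoment q 0 * qPochInf_neg_mul_qPochInf_sq hq0 hq1

lemma jacksonMoment_zero_ne_zero {q : ℝ} (hq0 : 0 < q) (hq1 : q < 1) :
    jacksonMoment q 0 ≠ 0 := by
  rw [jacksonMoment_zero hq0 hq1]
  exact mul_ne_zero (qPochInf_ne_zero hq0 hq1 hq1)
    (pow_ne_zero _ (qPochInf_ne_zero hq0 hq1 (by linarith)))

/-- Since `(-1; q)_∞ = 2 (-q; q)_∞`, the denominator of the weight is twice the one-sided mass. -/
lemma weight_pow {q : ℝ} (hq0 : 0 < q) (hq1 : q < 1) (k : ℕ) :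
    weight q (q ^ k) = weightNum q k / (2 * jacksonMoment q 0) := by
  rw [weight, weightNum, jacksonMoment_zero hq0 hq1, qPochInf_eq_mul (-1) hq0 hq1]
  congr 1
  ring_nf

lemma weight_neg (q x : ℝ) : weight q (-x) = weight q x := by
  rw [weight, weight, mul_neg, neg_neg, mul_comm (qPochInf (-(q * x)) q)]

/-- The functional `f ↦ (1 - q)⁻¹ ∫_{-1}^1 f(x) ω(x) d_q x` on polynomials. -/
def jacksonFunctional (q : ℝ) : ℝ[X] →ₗ[ℝ] ℝ :=
  Polynomial.lsum fun n =>
    (if Even n then jacksonMoment q n / jacksonMoment q 0 else 0) • LinearMap.id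

lemma jacksonFunctional_monomial (q a : ℝ) (n : ℕ) :
    jacksonFunctional q (monomial n a) =
      (if Even n then jacksonMoment q n / jacksonMoment q 0 else 0) * a := by
  simp only [jacksonFunctional, Polynomial.lsum_apply, LinearMap.smul_apply, LinearMap.id_apply,
    smul_eq_mul]
  exact sum_monomial_index a _ (mul_zero _)

lemma isMomentFunctional_jacksonFunctional {q : ℝ} (hq0 : 0 < q) (hq1 : q < 1) :
    IsMomentFunctional q (1 - q) (jacksonFunctional q) where
  map_one := by
    rw [← monomial_zero_one, jacksonFunctional_monomial]
    simp [jacksonMoment_zero_ne_zero hq0 hq1]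
  map_X := by
    rw [← monomial_one_one_eq_X, jacksonFunctional_monomial]
    simp
  map_X_pow_add_two n := by
    rw [X_pow_eq_monomial, X_pow_eq_monomial, jacksonFunctional_monomial,
      jacksonFunctional_monomial, one_sub_mul_geomInt, jacksonMoment_add_two hq0 hq1]
    have : Even (n + 2) ↔ Even n := by simp [Nat.even_add]
    simp only [this]
    split_ifs <;> ring

lemma summable_eval_mul_weightNum {q : ℝ} (hq0 : 0 < q) (hq1 : q < 1) (f : ℝ[X]) (ε : ℝ) :
    Summable fun k : ℕ => q ^ k * f.eval (ε * q ^ k) * weightNum q k := by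
  induction f using Polynomial.induction_on' with
  | add f g hf hg =>
    refine (hf.add hg).congr fun k => ?_
    rw [eval_add]
    ring
  | monomial n a =>
    refine ((summable_jacksonMoment hq0 hq1 n).mul_left (a * ε ^ n)).congr fun k => ?_
    rw [eval_monomial]
    ring

/-- Over the nodes `±q^k` odd monomials cancel and even ones double. -/
lemma tsum_eval_mul_weightNum {q : ℝ} (hq0 : 0 < q) (hq1 : q < 1) (f : ℝ[X]) :
    ∑' k : ℕ, q ^ k * f.eval (1 * q ^ k) * weightNum q k +
        ∑' k : ℕ, q ^ k * f.eval (-1 * q ^ k) * weightNum q k =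
      2 * jacksonMoment q 0 * jacksonFunctional q f := by
  induction f using Polynomial.induction_on' with
  | add f g hf hg =>
    have e (ε : ℝ) : ∑' k : ℕ, q ^ k * (f + g).eval (ε * q ^ k) * weightNum q k =
        ∑' k : ℕ, q ^ k * f.eval (ε * q ^ k) * weightNum q k +
          ∑' k : ℕ, q ^ k * g.eval (ε * q ^ k) * weightNum q k := by
      rw [← (summable_eval_mul_weightNum hq0 hq1 f ε).tsum_add
        (summable_eval_mul_weightNum hq0 hq1 g ε)]
      refine tsum_congr fun k => ?_
      rw [eval_add]
      ring
    rw [e, e, map_add]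
    linear_combination hf + hg
  | monomial n a =>
    have e (ε : ℝ) : ∑' k : ℕ, q ^ k * (monomial n a).eval (ε * q ^ k) * weightNum q k =
        a * ε ^ n * jacksonMoment q n := by
      rw [jacksonMoment, ← tsum_mul_left]
      refine tsum_congr fun k => ?_
      rw [eval_monomial]
      ring
    have h0 := jacksonMoment_zero_ne_zero hq0 hq1
    rw [e, e, jacksonFunctional_monomial]
    rcases Nat.even_or_odd n with h | h
    · rw [if_pos h, h.neg_one_pow]
      field_simp
      ring
    · rw [if_neg (Nat.not_even_iff_odd.2 h), h.neg_one_pow]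
      ring

/-- The sign `ε` pulled out of the node turns the difference in `jacksonIntegral` into a sum over
both halves. -/
lemma jackson_term {q : ℝ} (hq0 : 0 < q) (hq1 : q < 1) (f : ℝ[X]) {ε : ℝ}
    (hε : ε = 1 ∨ ε = -1) (k : ℕ) :
    ε * q ^ k * (f.eval (ε * q ^ k) * weight q (ε * q ^ k)) =
      ε / (2 * jacksonMoment q 0) * (q ^ k * f.eval (ε * q ^ k) * weightNum q k) := by
  have : weight q (ε * q ^ k) = weightNum q k / (2 * jacksonMoment q 0) := by
    rcases hε with rfl | rfl
    · rw [one_mul, weight_pow hq0 hq1]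
    · rw [neg_one_mul, weight_neg, weight_pow hq0 hq1]
  rw [this]
  ring

lemma jacksonIntegrable_eval_mul_weight {q : ℝ} (hq0 : 0 < q) (hq1 : q < 1) (f : ℝ[X]) :
    JacksonIntegrable q (fun x => f.eval x * weight q x) (-1) 1 := by
  constructor
  · simp only [jackson_term hq0 hq1 f (Or.inr rfl)]
    exact (summable_eval_mul_weightNum hq0 hq1 f (-1)).mul_left _
  · simp only [jackson_term hq0 hq1 f (Or.inl rfl)]
    exact (summable_eval_mul_weightNum hq0 hq1 f 1).mul_left _

lemma jacksonIntegral_eval_mul_weight {q : ℝ} (hq0 : 0 < q) (hq1 : q < 1) (f : ℝ[X]) :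
    jacksonIntegral q (fun x => f.eval x * weight q x) (-1) 1 =
      (1 - q) * jacksonFunctional q f := by
  rw [jacksonIntegral, jacksonIntegralZero, jacksonIntegralZero]
  simp only [jackson_term hq0 hq1 f (Or.inr rfl), jackson_term hq0 hq1 f (Or.inl rfl)]
  rw [tsum_mul_left, tsum_mul_left]
  have h0 := jacksonMoment_zero_ne_zero hq0 hq1
  have h := tsum_eval_mul_weightNum hq0 hq1 f
  have h' : jacksonFunctional q f = (∑' k : ℕ, q ^ k * f.eval (1 * q ^ k) * weightNum q k +
        ∑' k : ℕ, q ^ k * f.eval (-1 * q ^ k) * weightNum q k) / (2 * jacksonMoment q 0) := by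
    rw [h]
    field_simp
  rw [h']
  ring

/-! ### Moments of the ensemble -/

/-- The polynomial factor of the integrand of the individual moments. -/
def momentPoly (q : ℝ) (p j : ℕ) : ℝ[X] :=
  (1 / ((1 - q) * qPoch q q j * q ^ (j * (j - 1) / 2))) • (X ^ (2 * p) * monicPoly q (1 - q) j ^ 2)

lemma momentIntegrand_eq {q : ℝ} (hq0 : 0 < q) (hq1 : q < 1) (p j : ℕ) :
    momentIntegrand q p j = fun x => (momentPoly q p j).eval x * weight q x := by
  funext x
  rw [momentIntegrand, momentPoly, eval_smul, eval_mul, eval_pow, eval_pow, eval_X,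
    eval_monicPoly hq0 hq1, (even_two_mul p).pow_abs, smul_eq_mul]
  ring

/-- As `(q; q)_j = (1 - q)^j [j]!`, the normalisation is the squared norm of `P_j` at `s = 1 - q`,
and the scaling `(1 - q)^{-p}` removes `s^p`. -/
lemma scaledMoment_eq_momentSum {q : ℝ} (hq0 : 0 < q) (hq1 : q < 1) (p j : ℕ) :
    scaledMoment q p j = momentSum q p j := by
  rw [scaledMoment, moment, momentIntegrand_eq hq0 hq1, jacksonIntegral_eval_mul_weight hq0 hq1,
    momentPoly, map_smul, (isMomentFunctional_jacksonFunctional hq0 hq1).map_X_pow_mul_sq hq0,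
    qPoch_self_eq, Nat.choose_two_right, smul_eq_mul]
  have h1 : 1 - q ≠ 0 := by linarith
  have h2 := (geomFactorial_pos hq0 j).ne'
  have h3 := hq0.ne'
  field_simp

lemma pow_mul_density_eq {q : ℝ} (hq0 : 0 < q) (hq1 : q < 1) (p N : ℕ) (x : ℝ) :
    |x| ^ (2 * p) * density q N x =
      (∑ j ∈ range N, momentPoly q p j).eval x * weight q x := by
  rw [density, eval_finsetSum, mul_sum, sum_mul, mul_sum, sum_mul]
  refine sum_congr rfl fun j _ => ?_
  rw [momentPoly, eval_smul, eval_mul, eval_pow, eval_pow, eval_X,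
    eval_monicPoly hq0 hq1, (even_two_mul p).pow_abs, smul_eq_mul]
  field_simp

/-- Change of variables node by node, used with `a = ±1` and `y = q^k`: the root in the density
cancels that of the node, and `|x|^{2p}` yields `(1 - q)^{-p}`. -/
lemma scaledDensity_term {q : ℝ} (hq1 : q < 1) (p N : ℕ) (a y : ℝ) :
    a * (1 / √(1 - q)) * y *
        (|a * (1 / √(1 - q)) * y| ^ (2 * p) * scaledDensity q N (a * (1 / √(1 - q)) * y)) =
      1 / (1 - q) ^ p * (a * y * (|a * y| ^ (2 * p) * density q N (a * y))) := by
  have h : 0 < √(1 - q) := Real.sqrt_pos.2 (by linarith)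
  have e : √(1 - q) * (a * (1 / √(1 - q)) * y) = a * y := by
    field_simp
  have e2 : (√(1 - q)) ^ (2 * p) = (1 - q) ^ p := by
    rw [pow_mul, Real.sq_sqrt (by linarith)]
  rw [scaledDensity, e, show a * (1 / √(1 - q)) * y = a * y / √(1 - q) by ring, abs_div,
    abs_of_pos h, div_pow, e2]
  field_simp

lemma jacksonIntegrable_scaledDensity {q : ℝ} (hq0 : 0 < q) (hq1 : q < 1) (p N : ℕ) :
    JacksonIntegrable q (fun x => |x| ^ (2 * p) * scaledDensity q N x)
      (-(1 / √(1 - q))) (1 / √(1 - q)) := by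
  have h := jacksonIntegrable_eval_mul_weight hq0 hq1 (∑ j ∈ range N, momentPoly q p j)
  simp only [← pow_mul_density_eq hq0 hq1] at h
  rw [← neg_one_mul (1 / √(1 - q)), ← one_mul (1 / √(1 - q)), ← mul_assoc, mul_one]
  constructor
  · simpa only [scaledDensity_term hq1] using h.1.mul_left (1 / (1 - q) ^ p)
  · simpa only [scaledDensity_term hq1] using h.2.mul_left (1 / (1 - q) ^ p)

lemma scaledSpectralMoment_eq_sum {q : ℝ} (hq0 : 0 < q) (hq1 : q < 1) (p N : ℕ) :
    scaledSpectralMoment q N p = ∑ j ∈ range N, momentSum q p j := by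
  have h : scaledSpectralMoment q N p = 1 / (1 - q) ^ p *
      jacksonIntegral q (fun x => |x| ^ (2 * p) * density q N x) (-1) 1 := by
    rw [scaledSpectralMoment, ← neg_one_mul (1 / √(1 - q)), ← one_mul (1 / √(1 - q)),
      ← mul_assoc, mul_one, jacksonIntegral, jacksonIntegral, jacksonIntegralZero,
      jacksonIntegralZero, jacksonIntegralZero, jacksonIntegralZero]
    simp only [scaledDensity_term hq1, tsum_mul_left]
    ring
  rw [h]
  simp only [pow_mul_density_eq hq0 hq1]
  rw [jacksonIntegral_eval_mul_weight hq0 hq1, map_sum, mul_sum, mul_sum]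
  refine sum_congr rfl fun j _ => ?_
  rw [← scaledMoment_eq_momentSum hq0 hq1, scaledMoment, moment, momentIntegrand_eq hq0 hq1,
    jacksonIntegral_eval_mul_weight hq0 hq1]

end

end QGUE

namespace QGUE

open Finset Polynomial MeasureTheory Filter Topology

noncomputable section

/-! ### The Gaussian side -/

lemma integrable_pow_mul_gaussianWeight (n : ℕ) :
    Integrable fun x : ℝ => x ^ n * gaussianWeight x := by
  have h := (integrable_rpow_mul_exp_neg_mul_sq (b := 1 / 2) (by norm_num) (s := n)
    (by have : (0 : ℝ) ≤ n := by positivity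
        linarith)).div_const √(2 * Real.pi)
  refine h.congr (Eventually.of_forall fun x => ?_)
  simp only [Real.rpow_natCast, gaussianWeight]
  rw [mul_div_assoc, show -(1 / 2) * x ^ 2 = -x ^ 2 / 2 by ring]

lemma hasDerivAt_gaussianWeight (x : ℝ) : HasDerivAt gaussianWeight (-x * gaussianWeight x) x := by
  have h : HasDerivAt (fun x : ℝ => -x ^ 2 / 2) (-x) x := by
    have := ((hasDerivAt_pow 2 x).neg).div_const 2
    refine this.congr_deriv ?_
    simp
    ring
  refine (h.exp.div_const √(2 * Real.pi)).congr_deriv ?_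
  rw [gaussianWeight]
  ring

lemma integral_gaussianWeight : ∫ x : ℝ, gaussianWeight x = 1 := by
  have h := integral_gaussian (1 / 2)
  have e : ∀ x : ℝ, gaussianWeight x = Real.exp (-(1 / 2) * x ^ 2) / √(2 * Real.pi) := by
    intro x
    rw [gaussianWeight, show -(1 / 2) * x ^ 2 = -x ^ 2 / 2 by ring]
  simp only [e]
  rw [integral_div, h, show Real.pi / (1 / 2) = 2 * Real.pi by ring]
  exact div_self (Real.sqrt_pos.2 (by positivity)).ne'

/-- The derivative of `x^n` times the weight integrates to zero. At `n = 0` the factor `n` makes the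
truncated exponent irrelevant. -/
lemma integral_pow_add_one_mul_gaussianWeight (n : ℕ) :
    ∫ x : ℝ, x ^ (n + 1) * gaussianWeight x = n * ∫ x : ℝ, x ^ (n - 1) * gaussianWeight x := by
  have hd (x : ℝ) : HasDerivAt (fun x : ℝ => x ^ n * gaussianWeight x)
      (n * (x ^ (n - 1) * gaussianWeight x) - x ^ (n + 1) * gaussianWeight x) x := by
    refine ((hasDerivAt_pow n x).mul (hasDerivAt_gaussianWeight x)).congr_deriv ?_
    ring
  have h1 := (integrable_pow_mul_gaussianWeight (n - 1)).const_mul (n : ℝ)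
  have h2 := integrable_pow_mul_gaussianWeight (n + 1)
  have h := integral_eq_zero_of_hasDerivAt_of_integrable hd (h1.sub h2)
    (integrable_pow_mul_gaussianWeight n)
  rw [integral_sub h1 h2, integral_const_mul] at h
  linarith

lemma integrable_eval_mul_gaussianWeight (f : ℝ[X]) :
    Integrable fun x : ℝ => f.eval x * gaussianWeight x := by
  induction f using Polynomial.induction_on' with
  | add f g hf hg => simpa only [eval_add, add_mul] using! hf.add hg
  | monomial n a =>
    simpa only [eval_monomial, mul_assoc] using (integrable_pow_mul_gaussianWeight n).const_mul a

/-- Integration of polynomials against the standard Gaussian. -/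
def gaussianFunctional : ℝ[X] →ₗ[ℝ] ℝ where
  toFun f := ∫ x : ℝ, f.eval x * gaussianWeight x
  map_add' f g := by
    simp only [eval_add, add_mul]
    exact integral_add (integrable_eval_mul_gaussianWeight f) (integrable_eval_mul_gaussianWeight g)
  map_smul' c f := by
    simp only [eval_smul, smul_eq_mul, mul_assoc, RingHom.id_apply]
    exact integral_const_mul _ _

lemma isMomentFunctional_gaussianFunctional : IsMomentFunctional 1 1 gaussianFunctional where
  map_one := by simpa [gaussianFunctional] using integral_gaussianWeight
  map_X := by simpa [gaussianFunctional] using integral_pow_add_one_mul_gaussianWeight 0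
  map_X_pow_add_two n := by
    simpa [gaussianFunctional, geomInt_one_left] using
      integral_pow_add_one_mul_gaussianWeight (n + 1)

/-- The Appell property; it converts `hermite_succ`, which involves a derivative, into the
three-term recurrence. -/
lemma derivative_hermite_succ (n : ℕ) :
    derivative (hermite (n + 1)) = ((n : ℤ[X]) + 1) * hermite n := by
  induction n with
  | zero => simp
  | succ n ih =>
    rw [hermite_succ (n + 1), derivative_sub, derivative_mul, derivative_X, ih, derivative_mul,
      hermite_succ n]
    simp
    ring

lemma map_hermite_eq_monicPoly (n : ℕ) :
    (hermite n).map (Int.castRingHom ℝ) = monicPoly 1 1 n := by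
  induction n using Nat.strong_induction_on with
  | _ n ih =>
  match n with
  | 0 => simp [monicPoly]
  | 1 => simp [monicPoly]
  | n + 2 =>
    rw [hermite_succ, derivative_hermite_succ, monicPoly, ← ih n (by omega),
      ← ih (n + 1) (by omega), geomInt_one_left, Polynomial.map_sub, Polynomial.map_mul,
      Polynomial.map_mul, smul_eq_C_mul]
    simp

lemma geomFactorial_one_left (n : ℕ) : geomFactorial 1 n = n.factorial := by
  rw [geomFactorial, ← prod_range_add_one_eq_factorial, Nat.cast_prod]
  exact prod_congr rfl fun _ _ => geomInt_one_left _

/-- The normal ordering argument requires only `0 < q`, so it applies verbatim at `q = s = 1`. -/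
lemma gueMoment_eq_momentSum (p j : ℕ) : gueMoment p j = momentSum 1 p j := by
  have h := isMomentFunctional_gaussianFunctional.map_X_pow_mul_sq one_pos p j
  simp only [one_pow, one_mul, mul_one, geomFactorial_one_left] at h
  have hj : (j.factorial : ℝ) ≠ 0 := by positivity
  rw [← div_eq_iff hj] at h
  rw [← h, gueMoment, gaussianFunctional, LinearMap.coe_mk, AddHom.coe_mk, ← integral_div]
  congr 1
  funext x
  rw [← map_hermite_eq_monicPoly, eval_mul, eval_pow, eval_pow, eval_X, eval_map, aeval_def,
    algebraMap_int_eq]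
  ring

/-! ### The limit `q → 1` -/

lemma continuous_geomInt (n : ℕ) : Continuous fun q : ℝ => geomInt q n := by
  unfold geomInt
  fun_prop

/-- All denominators are products of sums `1 + q + ⋯`, positive for `q > 0`. -/
lemma continuousAt_momentSum {q : ℝ} (hq : 0 < q) (p j : ℕ) :
    ContinuousAt (fun q => momentSum q p j) q := by
  have h1 (n : ℕ) : Continuous fun q : ℝ => geomFactorial q n :=
    continuous_finsetProd _ fun _ _ => continuous_geomInt _
  have h2 (n : ℕ) : Continuous fun q : ℝ => geomEvenFactorial q n :=
    continuous_finsetProd _ fun _ _ => continuous_geomInt _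
  have h3 (n k : ℕ) : Continuous fun q : ℝ => geomDescFactorial q n k :=
    continuous_finsetProd _ fun _ _ => continuous_geomInt _
  unfold momentSum
  refine tendsto_finsetSum _ fun l _ => ?_
  refine ContinuousAt.mul (ContinuousAt.mul (by fun_prop) ?_) ?_
  · exact (h3 j l).continuousAt.div (h1 l).continuousAt (geomFactorial_pos hq l).ne'
  · exact (h1 _).continuousAt.div ((h2 _).mul (h1 l)).continuousAt
      (mul_pos (geomEvenFactorial_pos hq _) (geomFactorial_pos hq l)).ne'

lemma momentSum_one (p j : ℕ) :
    momentSum 1 p j = ((2 * p - 1).doubleFactorial : ℝ) *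
      ∑ l ∈ range (p + 1), (j.choose l : ℝ) * (p.choose l : ℝ) * 2 ^ l := by
  have h2 (n : ℕ) : geomEvenFactorial 1 n = 2 ^ n * n.factorial := by
    induction n with
    | zero => simp
    | succ n ih =>
      rw [geomEvenFactorial_succ, ih, geomInt_one_left, Nat.factorial_succ]
      push_cast
      ring
  have h3 (k : ℕ) : geomDescFactorial 1 j k = k.factorial * j.choose k := by
    rw [← Nat.cast_mul, ← Nat.descFactorial_eq_factorial_mul_choose, Nat.descFactorial_eq_prod_range,
      geomDescFactorial]
    simp [geomInt_one_left]
  have h4 : ((2 * p).factorial : ℝ) = (2 * p - 1).doubleFactorial * (2 ^ p * p.factorial) := by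
    -- At `p = 0` the truncated `2 * p - 1` is `0`, and `0!! = 1` agrees with the convention `(-1)!!
    -- = 1`.
    rcases p with _ | p
    · simp
    · have h := Nat.factorial_eq_mul_doubleFactorial (2 * p + 1)
      rw [show 2 * p + 1 + 1 = 2 * (p + 1) by ring, Nat.doubleFactorial_two_mul] at h
      rw [h, show 2 * (p + 1) - 1 = 2 * p + 1 by omega]
      push_cast
      ring
  rw [momentSum, mul_sum]
  refine sum_congr rfl fun l hl => ?_
  have hl : l ≤ p := by simpa [Nat.lt_succ_iff] using hl
  obtain ⟨i, rfl⟩ := Nat.exists_eq_add_of_le hl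
  rw [geomFactorial_one_left, geomFactorial_one_left, h2, h3, h4, Nat.add_sub_cancel_left, one_pow, Nat.cast_choose ℝ hl,
    Nat.add_sub_cancel_left]
  have := (Nat.cast_pos (α := ℝ)).2 l.factorial_pos
  have := (Nat.cast_pos (α := ℝ)).2 i.factorial_pos
  field_simp
  ring

/-- The hockey-stick identity, which sums the individual GUE moments over `j`. -/
lemma sum_range_choose_eq (N l : ℕ) : ∑ j ∈ range N, j.choose l = N.choose (l + 1) := by
  induction N with
  | zero => simp
  | succ N ih => rw [sum_range_succ, ih, Nat.choose_succ_succ', add_comm]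

lemma gueSpectralMoment_eq (N p : ℕ) :
    gueSpectralMoment N p = ((2 * p - 1).doubleFactorial : ℝ) *
      ∑ l ∈ range (p + 1), (N.choose (l + 1) : ℝ) * (p.choose l : ℝ) * 2 ^ l := by
  simp only [gueSpectralMoment, gueMoment_eq_momentSum, momentSum_one]
  rw [← mul_sum, sum_comm]
  simp only [← sum_mul, ← sum_range_choose_eq, Nat.cast_sum]

lemma eventually_mem_Ioo : ∀ᶠ q : ℝ in 𝓝[<] 1, q ∈ Set.Ioo 0 1 :=
  Ioo_mem_nhdsLT one_pos

lemma tendsto_momentSum (p j : ℕ) :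
    Tendsto (fun q => momentSum q p j) (𝓝[<] 1) (𝓝 (gueMoment p j)) := by
  rw [gueMoment_eq_momentSum]
  exact (continuousAt_momentSum one_pos p j).tendsto.mono_left nhdsWithin_le_nhds

end

end QGUE

/-! ### Positive sum formulas and the limit to the GUE. -/

theorem theorem2p1 (p : ℕ) :
    -- the positive sum formulas, for every `q` in `(0, 1)`
    (∀ q : ℝ, 0 < q → q < 1 →
      (∀ j : ℕ,
        QGUE.JacksonIntegrable q (QGUE.momentIntegrand q p j) (-1) 1 ∧
        QGUE.scaledMoment q p j =
          ∑ l ∈ Finset.range (p + 1),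
            q ^ (((j : ℤ) - l) * (2 * p - l) + (l : ℤ) * (l - 1) / 2) * QGUE.qBinom q j l *
              (QGUE.qFactorial q (2 * p) /
                (QGUE.qDoubleFactorial q (2 * p - 2 * l) * QGUE.qFactorial q l))) ∧
      (∀ N : ℕ,
        QGUE.JacksonIntegrable q (fun x => |x| ^ (2 * p) * QGUE.scaledDensity q N x)
          (-(1 / Real.sqrt (1 - q))) (1 / Real.sqrt (1 - q)) ∧
        QGUE.scaledSpectralMoment q N p =
          ∑ j ∈ Finset.range N, ∑ l ∈ Finset.range (p + 1),
            q ^ (((j : ℤ) - l) * (2 * p - l) + (l : ℤ) * (l - 1) / 2) * QGUE.qBinom q j l *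
              (QGUE.qFactorial q (2 * p) /
                (QGUE.qDoubleFactorial q (2 * p - 2 * l) * QGUE.qFactorial q l)))) ∧
    -- the limit `q → 1⁻` gives the moments of the GUE and their positive sum formulas
    (∀ j : ℕ,
      Filter.Tendsto (fun q : ℝ => QGUE.scaledMoment q p j) (nhdsWithin 1 (Set.Iio 1))
        (nhds (QGUE.gueMoment p j)) ∧
      QGUE.gueMoment p j =
        (Nat.doubleFactorial (2 * p - 1) : ℝ) *
          ∑ l ∈ Finset.range (p + 1), (Nat.choose j l : ℝ) * (Nat.choose p l : ℝ) * 2 ^ l) ∧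
    (∀ N : ℕ,
      Filter.Tendsto (fun q : ℝ => QGUE.scaledSpectralMoment q N p) (nhdsWithin 1 (Set.Iio 1))
        (nhds (QGUE.gueSpectralMoment N p)) ∧
      QGUE.gueSpectralMoment N p =
        (Nat.doubleFactorial (2 * p - 1) : ℝ) *
          ∑ l ∈ Finset.range (p + 1),
            (Nat.choose N (l + 1) : ℝ) * (Nat.choose p l : ℝ) * 2 ^ l) := by
  refine ⟨fun q hq0 hq1 => ⟨fun j => ⟨?_, ?_⟩, fun N => ⟨?_, ?_⟩⟩, fun j => ⟨?_, ?_⟩,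
    fun N => ⟨?_, ?_⟩⟩
  · rw [QGUE.momentIntegrand_eq hq0 hq1]
    exact QGUE.jacksonIntegrable_eval_mul_weight hq0 hq1 _
  · rw [QGUE.scaledMoment_eq_momentSum hq0 hq1, QGUE.momentSum_eq hq0 hq1.ne]
  · exact QGUE.jacksonIntegrable_scaledDensity hq0 hq1 p N
  · rw [QGUE.scaledSpectralMoment_eq_sum hq0 hq1]
    exact Finset.sum_congr rfl fun j _ => QGUE.momentSum_eq hq0 hq1.ne p j
  · refine (QGUE.tendsto_momentSum p j).congr' ?_
    -- The closed form is available only on `(0, 1)`, which is a left neighbourhood of `1`.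
    filter_upwards [QGUE.eventually_mem_Ioo] with q hq
    exact (QGUE.scaledMoment_eq_momentSum hq.1 hq.2 p j).symm
  · rw [QGUE.gueMoment_eq_momentSum, QGUE.momentSum_one]
  · refine (tendsto_finsetSum _ fun j _ => QGUE.tendsto_momentSum p j).congr' ?_
    filter_upwards [QGUE.eventually_mem_Ioo] with q hq
    exact (QGUE.scaledSpectralMoment_eq_sum hq.1 hq.2 p N).symm
  · exact QGUE.gueSpectralMoment_eq N p
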